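/- Notation. For $X,Y\subseteq\omega$ let $X\oplus Y=\{2n : n\in X\}\cup\{2n+1 : n\in Y\}$ and $\overline{X}=\omega\setminus X$; for partial functions $f,g:\omega\rightharpoonup\omega$ let $(f\oplus g)(2n)\simeq f(n)$ and $(f\oplus g)(2n+1)\simeq g(n)$. Let $\Phi_e^{h}$ denote the partial function computed by the $e$-th oracle program with partial oracle $h$, where a computation is undefined as soon as it queries $h$ at a point where $h$ is undefined. Scott's graph model $\mathcal{G}$ has as elements all sets $U\subseteq\omega$, with application $$U\cdot V=\{n\in\omega : \exists u\,(\langle n,u\rangle\in U\wedge D_u\subseteq V)\},$$ where $D_u$ is the finite set with canonical code $u$. For $Y\subseteq\omega$, $\mathcal{G}^{Y}$ is the smallest sub-pca of $\mathcal{G}$ containing $Y$ and all c.e. sets, i.e. the smallest family of sets that contains $Y$ and all c.e. sets and is closed under application. (Its elements are the sets enumeration-reducible to $Y$.) Van Oosten's model $\mathcal{B}$ has as elements all partial functions $f:\omega\rightharpoonup\omega$, with application $f\cdot g=\Phi_{f(0)}^{f\oplus g}$ (the nowhere defined function if $f(0)$ is undefined). For $X\subseteq\omega$, $\mathcal{B}^{X}$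 is the restriction of $\mathcal{B}$ to the partial $X$-computable functions. A weak embedding of a partial combinatory algebra $\mathcal{A}$ into another one $\mathcal{C}$ is an injection $F:\mathcal{A}\to\mathcal{C}$ such that for all $a,b\in\mathcal{A}$, if $a\cdot b$ is defined in $\mathcal{A}$, then $F(a)\cdot F(b)$ is defined in $\mathcal{C}$ and equals $F(a\cdot b)$. Theorem. For every $X\subseteq\omega$ there is no weak embedding of $\mathcal{G}^{X\oplus\overline{X}}$ into $\mathcal{B}^{X}$. -/

import Mathlib

/-! ## Partial applicative systems and weak embeddings -/

/-- A partial applicative system: a type with a partial binary application. -/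
structure PAS where
  carrier : Type
  app : carrier → carrier → Part carrier

namespace PAS

/-- The restriction of a partial applicative system to a subset that is closed under application. -/
def restrict (A : PAS) (S : Set A.carrier)
    (hS : ∀ a ∈ S, ∀ b ∈ S, ∀ c ∈ A.app a b, c ∈ S) : PAS where
  carrier := S
  app a b := ⟨(A.app a b).Dom,
    fun h => ⟨(A.app a b).get h, hS a a.2 b b.2 _ (Part.get_mem h)⟩⟩

/-- A weak embedding: an injection `f` such that whenever `a · b` is defined,
`f a · f b` is defined and equal to `f (a · b)`. -/
structure WeakEmbedding (A B : PAS) where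
  toFun : A.carrier → B.carrier
  injective : Function.Injective toFun
  map_app : ∀ a b c : A.carrier, c ∈ A.app a b → toFun c ∈ B.app (toFun a) (toFun b)

end PAS

/-! ## Oracle computations with partial oracles -/

/-- The join `X ⊕ Y = {2n | n ∈ X} ∪ {2n + 1 | n ∈ Y}` of two sets. -/
def setJoin (X Y : Set ℕ) : Set ℕ :=
  {m | (∃ n ∈ X, m = 2 * n) ∨ (∃ n ∈ Y, m = 2 * n + 1)}

/-- The join `f ⊕ g` of two partial functions: `(f ⊕ g)(2n) ≃ f(n)`, `(f ⊕ g)(2n+1) ≃ g(n)`. -/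
def funJoin (f g : ℕ →. ℕ) : ℕ →. ℕ :=
  fun n => if n % 2 = 0 then f (n / 2) else g (n / 2)

open Classical in
/-- The characteristic function of a set of natural numbers. -/
noncomputable def charFun (X : Set ℕ) : ℕ →. ℕ :=
  fun n => Part.some (if n ∈ X then 1 else 0)

/-- Programs for oracle computations. The constructors are those of `Nat.RecursiveIn`. -/
inductive OracleCode : Type
  | zero : OracleCode
  | succ : OracleCode
  | left : OracleCode
  | right : OracleCode
  | oracle : OracleCode
  | pair : OracleCode → OracleCode → OracleCode
  | comp : OracleCode → OracleCode → OracleCode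
  | prec : OracleCode → OracleCode → OracleCode
  | rfind : OracleCode → OracleCode

namespace OracleCode

/-- The partial function computed by a program with a partial oracle `O`. Evaluation is strict:
a computation that queries `O` where `O` is undefined is itself undefined. -/
def eval (O : ℕ →. ℕ) : OracleCode → ℕ →. ℕ
  | zero => fun _ => 0
  | succ => Nat.succ
  | left => fun n => (Nat.unpair n).1
  | right => fun n => (Nat.unpair n).2
  | oracle => O
  | pair cf cg => fun n => Nat.pair <$> eval O cf n <*> eval O cg n
  | comp cf cg => fun n => eval O cg n >>= eval O cf
  | prec cf cg => fun p =>
      let (a, n) := Nat.unpair p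
      n.rec (eval O cf a) fun y IH => do
        let i ← IH
        eval O cg (Nat.pair a (Nat.pair y i))
  | rfind cf => fun a =>
      Nat.rfind fun n => (fun m => m = 0) <$> eval O cf (Nat.pair a n)

/-- The Gödel number of a program. -/
def encodeCode : OracleCode → ℕ
  | zero => 0
  | succ => 1
  | left => 2
  | right => 3
  | oracle => 4
  | pair cf cg => 2 * (2 * Nat.pair (encodeCode cf) (encodeCode cg)) + 5
  | comp cf cg => 2 * (2 * Nat.pair (encodeCode cf) (encodeCode cg) + 1) + 5
  | prec cf cg => (2 * (2 * Nat.pair (encodeCode cf) (encodeCode cg)) + 1) + 5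
  | rfind cf => (2 * (2 * encodeCode cf + 1) + 1) + 5

/-- The program with a given Gödel number. -/
def ofNatCode : ℕ → OracleCode
  | 0 => zero
  | 1 => succ
  | 2 => left
  | 3 => right
  | 4 => oracle
  | n + 5 =>
    let m := n.div2.div2
    have hm : m < n + 5 := by
      simp only [m, Nat.div2_val]
      omega
    have _m1 : m.unpair.1 < n + 5 := lt_of_le_of_lt m.unpair_left_le hm
    have _m2 : m.unpair.2 < n + 5 := lt_of_le_of_lt m.unpair_right_le hm
    match n.bodd, n.div2.bodd with
    | false, false => pair (ofNatCode m.unpair.1) (ofNatCode m.unpair.2)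
    | false, true => comp (ofNatCode m.unpair.1) (ofNatCode m.unpair.2)
    | true, false => prec (ofNatCode m.unpair.1) (ofNatCode m.unpair.2)
    | true, true => rfind (ofNatCode m)
termination_by n => n
decreasing_by all_goals first | exact _m1 | exact _m2 | exact hm

theorem ofNatCode_encodeCode (c : OracleCode) : ofNatCode (encodeCode c) = c := by
  induction c <;> simp [encodeCode, ofNatCode, Nat.div2_val, *]

/-- A partial function is computed by some program with oracle `O` if and only if it is
partial recursive in `O`. -/
theorem exists_eval_eq_iff (O f : ℕ →. ℕ) :
    (∃ c, eval O c = f) ↔ Nat.RecursiveIn {O} f := by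
  constructor
  · rintro ⟨c, rfl⟩
    induction c with
    | zero => exact .zero
    | succ => exact .succ
    | left => exact .left
    | right => exact .right
    | oracle => exact .oracle _ rfl
    | pair _ _ h₁ h₂ => exact .pair h₁ h₂
    | comp _ _ h₁ h₂ => exact .comp h₁ h₂
    | prec _ _ h₁ h₂ => exact .prec h₁ h₂
    | rfind _ h₁ => exact .rfind h₁
  · intro h
    induction h with
    | zero => exact ⟨zero, rfl⟩
    | succ => exact ⟨succ, rfl⟩
    | left => exact ⟨left, rfl⟩
    | right => exact ⟨right, rfl⟩
    | oracle g hg => exact ⟨oracle, hg.symm⟩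
    | pair _ _ h₁ h₂ =>
      obtain ⟨c₁, rfl⟩ := h₁
      obtain ⟨c₂, rfl⟩ := h₂
      exact ⟨pair c₁ c₂, rfl⟩
    | comp _ _ h₁ h₂ =>
      obtain ⟨c₁, rfl⟩ := h₁
      obtain ⟨c₂, rfl⟩ := h₂
      exact ⟨comp c₁ c₂, rfl⟩
    | prec _ _ h₁ h₂ =>
      obtain ⟨c₁, rfl⟩ := h₁
      obtain ⟨c₂, rfl⟩ := h₂
      exact ⟨prec c₁ c₂, rfl⟩
    | rfind _ h₁ =>
      obtain ⟨c₁, rfl⟩ := h₁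
      exact ⟨rfind c₁, rfl⟩

end OracleCode

/-- `Φ_e^O`, the partial function computed by the `e`-th program with partial oracle `O`. -/
def oraclePhi (e : ℕ) (O : ℕ →. ℕ) : ℕ →. ℕ :=
  OracleCode.eval O (OracleCode.ofNatCode e)

/-! ## Van Oosten's model -/

/-- The application `f · g = Φ_{f(0)}^{f ⊕ g}` on partial functions; if `f(0)` is undefined,
the result is the nowhere defined function. -/
def vanOostenApp (f g : ℕ →. ℕ) : ℕ →. ℕ :=
  fun n => f 0 >>= fun e => oraclePhi e (funJoin f g) n

/-- Van Oosten's model `𝓑`. -/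
def vanOostenModel : PAS where
  carrier := ℕ →. ℕ
  app f g := Part.some (vanOostenApp f g)

/-- The partial `X`-computable functions. -/
def partialComputableIn (X : Set ℕ) : Set (ℕ →. ℕ) :=
  {f | Nat.RecursiveIn {charFun X} f}

theorem recursiveIn_funJoin {O : Set (ℕ →. ℕ)} {f g : ℕ →. ℕ}
    (hf : Nat.RecursiveIn O f) (hg : Nat.RecursiveIn O g) :
    Nat.RecursiveIn O (funJoin f g) := by
  have key : ∀ h : ℕ →. ℕ, Nat.RecursiveIn O h → Nat.RecursiveIn O (fun p : ℕ =>
      Nat.rec (motive := fun _ => Part ℕ) (Part.some 0)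
        (fun _ IH => IH >>= fun _ => h p.unpair.1) p.unpair.2) := by
    intro h hh
    refine (Nat.RecursiveIn.prec (f := fun _ => 0) (h := fun p => h (Nat.unpair p).1)
      .zero ?_).of_eq fun p => ?_
    · refine (Nat.RecursiveIn.comp hh .left).of_eq fun p => ?_
      exact Part.bind_some _ _
    · simp only [Nat.unpair_pair]
      rfl
  have prim : ∀ h : ℕ → ℕ, Primrec h → Nat.RecursiveIn O fun n => Part.some (h n) :=
    fun h hh => Nat.Primrec.recursiveIn (Primrec.nat_iff.1 hh)
  have h1 : Nat.RecursiveIn O fun n => Part.some (Nat.pair (n / 2) (1 - n % 2)) :=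
    prim _ (Primrec₂.natPair.comp (Primrec.nat_div.comp .id (.const 2))
      (Primrec.nat_sub.comp (.const 1) (Primrec.nat_mod.comp .id (.const 2))))
  have h2 : Nat.RecursiveIn O fun n => Part.some (Nat.pair (n / 2) (n % 2)) :=
    prim _ (Primrec₂.natPair.comp (Primrec.nat_div.comp .id (.const 2))
      (Primrec.nat_mod.comp .id (.const 2)))
  have h3 : Nat.RecursiveIn O fun p => Part.some (p.unpair.1 + p.unpair.2) :=
    prim _ (Primrec.nat_add.comp (Primrec.fst.comp Primrec.unpair)
      (Primrec.snd.comp Primrec.unpair))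
  refine (Nat.RecursiveIn.comp h3
    (Nat.RecursiveIn.pair (.comp (key f hf) h1) (.comp (key g hg) h2))).of_eq fun n => ?_
  rcases Nat.mod_two_eq_zero_or_one n with h | h
  · simp [funJoin, h, Seq.seq, Part.bind_assoc]
  · simp [funJoin, h, Seq.seq]

theorem vanOostenApp_mem {X : Set ℕ} {f g : ℕ →. ℕ} (hf : f ∈ partialComputableIn X)
    (hg : g ∈ partialComputableIn X) : vanOostenApp f g ∈ partialComputableIn X := by
  by_cases h : (f 0).Dom
  · have h2 : vanOostenApp f g = oraclePhi ((f 0).get h) (funJoin f g) := by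
      funext n
      have h3 : f 0 = Part.some ((f 0).get h) := (Part.some_get h).symm
      rw [vanOostenApp]
      conv_lhs => rw [h3]
      exact Part.bind_some _ _
    rw [h2]
    refine ((OracleCode.exists_eval_eq_iff _ _).1 ⟨_, rfl⟩).subst fun k hk => ?_
    rw [Set.mem_singleton_iff.1 hk]
    exact recursiveIn_funJoin hf hg
  · have h2 : vanOostenApp f g = fun _ => Part.none := by
      funext n
      rw [vanOostenApp, Part.eq_none_iff'.2 h]
      simp
    rw [h2]
    exact Nat.Partrec.recursiveIn Nat.Partrec.none

/-- The relativized van Oosten model `𝓑^X`: the partial `X`-computable functions with the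
application of `𝓑`. -/
def vanOostenModelRel (X : Set ℕ) : PAS :=
  vanOostenModel.restrict (partialComputableIn X) fun f hf g hg c hc => by
    rw [Part.mem_some_iff.1 hc]
    exact vanOostenApp_mem hf hg

/-! ## Scott's graph model -/

/-- The application `X · Y = {n | ∃ u, ⟨n, u⟩ ∈ X ∧ D_u ⊆ Y}` on sets of natural numbers, where
`D_u` is the finite set with canonical code `u = ∑ i ∈ D_u, 2 ^ i`. -/
def graphApp (X Y : Set ℕ) : Set ℕ :=
  {n | ∃ u, Nat.pair n u ∈ X ∧ ∀ i ∈ Finset.equivBitIndices u, i ∈ Y}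

/-- Scott's graph model `𝓖`. -/
def graphModel : PAS where
  carrier := Set ℕ
  app X Y := Part.some (graphApp X Y)

/-- The smallest class of sets that contains `Y` and all c.e. sets and is closed under the
application of the graph model. (As the combinators `k` and `s` of the graph model can be chosen
c.e., this is the smallest sub-pca containing `Y` and all c.e. sets.) -/
inductive GraphGenerated (Y : Set ℕ) : Set ℕ → Prop
  | base : GraphGenerated Y Y
  | ce (W : Set ℕ) (hW : REPred fun n => n ∈ W) : GraphGenerated Y W
  | app (U V : Set ℕ) (hU : GraphGenerated Y U) (hV : GraphGenerated Y V) :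
      GraphGenerated Y (graphApp U V)

/-- The pca `𝓖^Y`: the smallest sub-pca of the graph model containing `Y` and all c.e. sets. -/
def graphModelRel (Y : Set ℕ) : PAS :=
  graphModel.restrict {Z | GraphGenerated Y Z} fun U hU V hV c hc => by
    rw [Part.mem_some_iff.1 hc]
    exact GraphGenerated.app U V hU hV

/-! Let `J` be the join of `X` with its complement, and suppose that `f` is a weak embedding. The
contradiction comes from two properties.

Monotonicity (`IsEmbeddingOn.mono`): for decidable `U ⊆ V`, `f V` extends `f U`. Choose `K`
enumeration reducible to `J` whose complement is not (`REIn.exists_not_compl`). The graph model has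
elements `S` and `T` such that `T` applied to the `e`-fold `S`-shift of `K` is `V` if `e ∈ K` and
`U` otherwise. If `f U` had a value `y` at `m` that `f V` lacks, then `e ∉ K` would be equivalent to
the corresponding iterated application in Van Oosten's model giving `y` at `m`. This condition is
enumeration reducible to `J` (`reIn_vanOostenApp_iterate`), because graphs of partial `X`-computable
functions are.

Stability (`mem_vanOostenApp_of_extends`): oracle computations are sequential, so two computations
with compatible oracles ask the same queries, and program and argument may be mixed. The graph model
is not stable: let `A i` send `Y` to `{0}` if `i ∈ Y` and to `∅` otherwise. Then `A 1 · {1} = A 2 ·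
{2} = {0}`, while `A 1 · {2} = ∅`. By monotonicity all images lie below `f Set.univ`, so stability
makes `f ∅` extend `f {0}`. With monotonicity they coincide, against injectivity. -/

/-! ### Enumeration reducibility and its closure properties. -/

/-- `REIn J p`: the predicate `p` is enumeration reducible to the set `J`. -/
def REIn (J : Set ℕ) {α : Type*} [Primcodable α] (p : α → Prop) : Prop :=
  ∃ (R : α → ℕ → Prop) (L : ℕ → List ℕ), PrimrecRel R ∧ Primrec L ∧
    ∀ a, p a ↔ ∃ w, R a w ∧ ∀ i ∈ L w, i ∈ J

theorem REPred.exists_nat {α : Type*} [Primcodable α] {R : α → ℕ → Prop} (hR : PrimrecRel R) :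
    REPred fun a => ∃ w, R a w := by
  classical
  have h : Partrec fun a => Nat.rfind fun w => Part.some (decide (R a w)) :=
    Partrec.rfind (Computable₂.partrec₂ (Primrec.to_comp hR.decide))
  refine h.dom_re.of_eq fun a => ?_
  refine Nat.rfind_dom'.trans ?_
  simp

theorem PrimrecPred.rePred {α : Type*} [Primcodable α] {p : α → Prop} (hp : PrimrecPred p) :
    REPred p :=
  (REPred.exists_nat (R := fun a _ => p a) (hp.comp Primrec.fst)).of_eq fun a => by simp

theorem primrecRel_mem_equivBitIndices :
    PrimrecRel fun i u : ℕ => i ∈ Finset.equivBitIndices u := by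
  have hpow : Primrec fun x : ℕ × ℕ => 2 ^ x.1 := by
    have := Primrec.nat_iff.2 Nat.Primrec.pow
    refine (this.comp (Primrec₂.natPair.comp (Primrec.const 2) Primrec.fst)).of_eq fun x => ?_
    simp
  refine PrimrecPred.of_eq (p := fun x : ℕ × ℕ => x.2 / 2 ^ x.1 % 2 = 1) ?_ fun x => ?_
  · exact Primrec.eq.comp (Primrec.nat_mod.comp (Primrec.nat_div.comp Primrec.snd hpow)
      (Primrec.const 2)) (Primrec.const 1)
  · simp [Nat.testBit_eq_decide_div_mod_eq]

namespace REIn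

variable {J : Set ℕ} {α β γ : Type*} [Primcodable α] [Primcodable β] [Primcodable γ]

theorem of_eq {p q : α → Prop} (hp : REIn J p) (H : ∀ a, p a ↔ q a) : REIn J q :=
  (funext fun a => propext (H a) : p = q) ▸ hp

theorem of_witness {p : α → Prop} {R : α → γ → Prop} {L : γ → List ℕ} (hR : PrimrecRel R)
    (hL : Primrec L) (h : ∀ a, p a ↔ ∃ w, R a w ∧ ∀ i ∈ L w, i ∈ J) : REIn J p := by
  have hdec : Primrec fun k : ℕ => (Encodable.decode (α := γ) k).toList :=
    Primrec.optionToList.comp Primrec.decode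
  -- A number that decodes to nothing yields the empty list, hence witnesses nothing.
  refine ⟨fun a k => ∃ w ∈ (Encodable.decode (α := γ) k).toList, R a w,
    fun k => (Encodable.decode (α := γ) k).toList.flatMap L, ?_, ?_, fun a => ?_⟩
  · have h1 : PrimrecRel fun (l : List γ) (a : α) => ∃ w ∈ l, R a w :=
      PrimrecRel.exists_mem_list (R := fun w a => R a w) (hR.comp Primrec.snd Primrec.fst)
    exact h1.comp (hdec.comp Primrec.snd) Primrec.fst
  · exact Primrec.list_flatMap hdec (hL.comp Primrec.snd)
  · rw [h]
    constructor
    · rintro ⟨w, hw, hw'⟩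
      exact ⟨Encodable.encode w, by simpa using hw, by simpa using hw'⟩
    · rintro ⟨k, ⟨w, hw, hR⟩, hk⟩
      refine ⟨w, hR, fun i hi => hk i ?_⟩
      exact List.mem_flatMap.2 ⟨w, hw, hi⟩

theorem of_primrecPred {p : α → Prop} (hp : PrimrecPred p) : REIn J p :=
  of_witness (γ := ℕ) (R := fun a _ => p a) (L := fun _ => []) (hp.comp Primrec.fst)
    (Primrec.const []) fun a => by simp

theorem oracle : REIn J fun n => n ∈ J :=
  of_witness (γ := ℕ) (R := fun a w => a = w) (L := fun w => [w]) Primrec.eq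
    (Primrec.list_cons.comp Primrec.id (Primrec.const [])) fun a => by simp

theorem comp {p : β → Prop} {f : α → β} (hp : REIn J p) (hf : Primrec f) :
    REIn J fun a => p (f a) := by
  obtain ⟨R, L, hR, hL, h⟩ := hp
  exact ⟨fun a w => R (f a) w, L, hR.comp (hf.comp Primrec.fst) Primrec.snd, hL, fun a => h _⟩

theorem exists' {p : α → β → Prop} (hp : REIn J fun x : α × β => p x.1 x.2) :
    REIn J fun a => ∃ b, p a b := by
  obtain ⟨R, L, hR, hL, h⟩ := hp
  refine of_witness (γ := β × ℕ) (R := fun a w => R (a, w.1) w.2) (L := fun w => L w.2) ?_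
    (hL.comp Primrec.snd) fun a => ?_
  · exact hR.comp (Primrec.fst.pair (Primrec.fst.comp Primrec.snd))
      (Primrec.snd.comp Primrec.snd)
  · simp only [fun b => h (a, b), Prod.exists]

protected theorem and {p q : α → Prop} (hp : REIn J p) (hq : REIn J q) :
    REIn J fun a => p a ∧ q a := by
  obtain ⟨R, L, hR, hL, h⟩ := hp
  obtain ⟨R', L', hR', hL', h'⟩ := hq
  refine of_witness (γ := ℕ × ℕ) (R := fun a w => R a w.1 ∧ R' a w.2)
    (L := fun w => L w.1 ++ L' w.2) ?_ ?_ fun a => ?_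
  · exact PrimrecPred.and (hR.comp Primrec.fst (Primrec.fst.comp Primrec.snd))
      (hR'.comp Primrec.fst (Primrec.snd.comp Primrec.snd))
  · exact Primrec.list_append.comp (hL.comp Primrec.fst) (hL'.comp Primrec.snd)
  · rw [h, h']
    constructor
    · rintro ⟨⟨w, hw, hJ⟩, w', hw', hJ'⟩
      refine ⟨(w, w'), ⟨hw, hw'⟩, fun i hi => ?_⟩
      exact (List.mem_append.1 hi).elim (hJ i) (hJ' i)
    · rintro ⟨⟨w, w'⟩, ⟨hw, hw'⟩, hJ⟩
      exact ⟨⟨w, hw, fun i hi => hJ i (List.mem_append_left _ hi)⟩,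
        w', hw', fun i hi => hJ i (List.mem_append_right _ hi)⟩

protected theorem or {p q : α → Prop} (hp : REIn J p) (hq : REIn J q) :
    REIn J fun a => p a ∨ q a := by
  have h : REIn J fun a => ∃ b : Bool, (b = true → p a) ∧ (b = false → q a) := by
    obtain ⟨R, L, hR, hL, h⟩ := hp
    obtain ⟨R', L', hR', hL', h'⟩ := hq
    refine of_witness (γ := Bool × ℕ)
      (R := fun a w => (w.1 = true ∧ R a w.2) ∨ (w.1 = false ∧ R' a w.2))
      (L := fun w => bif w.1 then L w.2 else L' w.2) ?_ ?_ fun a => ?_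
    · have hb : ∀ b : Bool, PrimrecPred fun x : α × Bool × ℕ => x.2.1 = b := fun b =>
        Primrec.eq.comp (Primrec.fst.comp Primrec.snd) (Primrec.const b)
      exact PrimrecPred.or
        (PrimrecPred.and (hb _) (hR.comp Primrec.fst (Primrec.snd.comp Primrec.snd)))
        (PrimrecPred.and (hb _) (hR'.comp Primrec.fst (Primrec.snd.comp Primrec.snd)))
    · exact Primrec.cond Primrec.fst (hL.comp Primrec.snd) (hL'.comp Primrec.snd)
    · simp [h, h']
  exact h.of_eq fun a => by simp [or_comm]

/-- Finitely many witnesses are collected in one list, each paired with the `b` that it serves;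
superfluous pairs only strengthen the condition. -/
theorem forall_mem {p : α → β → Prop} {l : α → List β} (hp : REIn J fun x : α × β => p x.1 x.2)
    (hl : Primrec l) : REIn J fun a => ∀ b ∈ l a, p a b := by
  obtain ⟨R, L, hR, hL, h⟩ := hp
  refine of_witness (γ := List (β × ℕ))
    (R := fun a W => ∀ b ∈ l a, ∃ x ∈ W, x.1 = b ∧ R (a, b) x.2)
    (L := fun W => W.flatMap fun x => L x.2) ?_ ?_ fun a => ?_
  · have h1 : PrimrecRel fun (x : β × ℕ) (y : β × α) => x.1 = y.1 ∧ R (y.2, y.1) x.2 := by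
      refine PrimrecPred.and
        (Primrec.eq.comp (Primrec.fst.comp Primrec.fst) (Primrec.fst.comp Primrec.snd))
        (hR.comp ((Primrec.snd.comp Primrec.snd).pair (Primrec.fst.comp Primrec.snd))
          (Primrec.snd.comp Primrec.fst))
    have h2 : PrimrecRel fun (b : β) (y : α × List (β × ℕ)) =>
        ∃ x ∈ y.2, x.1 = b ∧ R (y.1, b) x.2 :=
      (PrimrecRel.exists_mem_list h1).comp (Primrec.snd.comp Primrec.snd)
        (Primrec.fst.pair (Primrec.fst.comp Primrec.snd))
    exact (PrimrecRel.forall_mem_list h2).comp (hl.comp Primrec.fst) Primrec.id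
  · exact Primrec.list_flatMap Primrec.id (hL.comp (Primrec.snd.comp Primrec.snd))
  · simp only [fun b => h (a, b)]
    constructor
    · intro H
      choose! w hw hJ using H
      refine ⟨(l a).map fun b => (b, w b), fun b hb => ⟨(b, w b), by simpa using hb, rfl, hw b hb⟩,
        fun i hi => ?_⟩
      simp only [List.mem_flatMap, List.mem_map] at hi
      obtain ⟨_, ⟨b, hb, rfl⟩, hi⟩ := hi
      exact hJ b hb i hi
    · rintro ⟨W, hW, hJ⟩ b hb
      obtain ⟨x, hx, rfl, hR⟩ := hW b hb
      exact ⟨x.2, hR, fun i hi => hJ i (List.mem_flatMap.2 ⟨x, hx, hi⟩)⟩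

theorem forall_lt {p : α → ℕ → Prop} {n : α → ℕ} (hp : REIn J fun x : α × ℕ => p x.1 x.2)
    (hn : Primrec n) : REIn J fun a => ∀ i < n a, p a i :=
  (hp.forall_mem (Primrec.list_range.comp hn)).of_eq fun a => by simp

/-- Serves both primitive recursion and iterated application. Only `c 0, ..., c n` matter, so the
sequence is coded by a list; a list that is too short is padded with `default` and still defines a
sequence. -/
theorem chain [Inhabited β] {base : α → β → Prop} {step : α → ℕ → β → β → Prop}
    (hbase : REIn J fun x : α × β => base x.1 x.2)
    (hstep : REIn J fun x : α × ℕ × β × β => step x.1 x.2.1 x.2.2.1 x.2.2.2) :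
    REIn J fun x : α × ℕ × β => ∃ c : ℕ → β, base x.1 (c 0) ∧
      (∀ i < x.2.1, step x.1 i (c i) (c (i + 1))) ∧ c x.2.1 = x.2.2 := by
  have hget : ∀ {δ : Type _} [Primcodable δ] {f : δ → List β} {g : δ → ℕ}, Primrec f →
      Primrec g → Primrec fun d => (f d).getD (g d) default := fun hf hg =>
    (Primrec.list_getD default).comp hf hg
  have key : REIn J fun x : α × ℕ × β => ∃ l : List β, base x.1 (l.getD 0 default) ∧
      (∀ i < x.2.1, step x.1 i (l.getD i default) (l.getD (i + 1) default)) ∧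
      l.getD x.2.1 default = x.2.2 := by
    refine exists' (.and (hbase.comp (.pair ?_ (hget .snd (.const 0)))) (.and (forall_lt
      (hstep.comp (f := fun y : ((α × ℕ × β) × List β) × ℕ => (y.1.1.1, y.2,
        y.1.2.getD y.2 default, y.1.2.getD (y.2 + 1) default)) (.pair ?_ (.pair .snd (.pair ?_ ?_))))
        ?_) (of_primrecPred (Primrec.eq.comp (hget .snd ?_) ?_))))
    · exact Primrec.fst.comp .fst
    · exact Primrec.fst.comp (Primrec.fst.comp .fst)
    · exact hget (Primrec.snd.comp .fst) .snd
    · exact hget (Primrec.snd.comp .fst) (Primrec.succ.comp .snd)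
    · exact Primrec.fst.comp (Primrec.snd.comp .fst)
    · exact Primrec.fst.comp (Primrec.snd.comp .fst)
    · exact Primrec.snd.comp (Primrec.snd.comp .fst)
  refine key.of_eq fun ⟨a, n, b⟩ => ⟨fun ⟨l, h⟩ => ⟨fun i => l.getD i default, h⟩, ?_⟩
  rintro ⟨c, h0, h1, h2⟩
  have hc : ∀ i ≤ n, ((List.range (n + 1)).map c).getD i default = c i := fun i hi => by
    simp [List.getD, List.getElem?_range (Nat.lt_succ_of_le hi)]
  refine ⟨(List.range (n + 1)).map c, ?_, fun i hi => ?_, ?_⟩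
  · rwa [hc 0 (Nat.zero_le _)]
  · rw [hc i (le_of_lt hi), hc (i + 1) hi]
    exact h1 i hi
  · rwa [hc n le_rfl]

/-- The reduction itself becomes a c.e. element of the graph model, the set of `⟨n, u⟩` such that
some witness for `n` needs only elements of `D_u`; applied to `J` it gives `A`. -/
theorem graphGenerated {A : Set ℕ} (hA : REIn J fun n => n ∈ A) : GraphGenerated J A := by
  obtain ⟨R, L, hR, hL, h⟩ := hA
  have hW : REPred fun x : ℕ => x ∈ {x : ℕ | ∃ w, R x.unpair.1 w ∧
      ∀ i ∈ L w, i ∈ Finset.equivBitIndices x.unpair.2} := by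
    refine REPred.exists_nat (R := fun x w => R (Nat.unpair x).1 w ∧
      ∀ i ∈ L w, i ∈ Finset.equivBitIndices (Nat.unpair x).2) (PrimrecPred.and ?_ ?_)
    · exact hR.comp (Primrec.fst.comp (Primrec.unpair.comp Primrec.fst)) Primrec.snd
    · exact (PrimrecRel.forall_mem_list primrecRel_mem_equivBitIndices).comp
        (hL.comp Primrec.snd) (Primrec.snd.comp (Primrec.unpair.comp Primrec.fst))
  convert GraphGenerated.app _ J (.ce _ hW) .base using 1
  ext n
  simp only [graphApp, h, Set.mem_ofPred_eq, Nat.unpair_pair]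
  constructor
  · rintro ⟨w, hw, hJ⟩
    refine ⟨Finset.equivBitIndices.symm (L w).toFinset, ⟨w, hw, fun i hi => ?_⟩, fun i hi => ?_⟩
    · rw [Equiv.apply_symm_apply]
      exact List.mem_toFinset.2 hi
    · rw [Equiv.apply_symm_apply] at hi
      exact hJ i (List.mem_toFinset.1 hi)
  · rintro ⟨u, ⟨w, hw, hi⟩, hu⟩
    exact ⟨w, hw, fun i h => hu i (hi i h)⟩

open Nat.Partrec in
-- Diagonal halting set for enumeration operators: `e ∈ K` when program `e` halts on `(e, l)` for
-- some finite list `l` from `J`.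
theorem exists_not_compl (J : Set ℕ) :
    ∃ K : Set ℕ, (REIn J fun n => n ∈ K) ∧ ¬ REIn J fun n => n ∉ K := by
  classical
  refine ⟨{e | ∃ l : List ℕ, (∀ i ∈ l, i ∈ J) ∧
    ((Denumerable.ofNat Code e).eval (Encodable.encode (e, l))).Dom}, ?_, ?_⟩
  · refine of_witness (γ := List ℕ × ℕ) (R := fun e w =>
      (Code.evaln w.2 (Denumerable.ofNat Code e) (Encodable.encode (e, w.1))).isSome = true)
      (L := Prod.fst) ?_ Primrec.fst fun e => ?_
    · refine Primrec.eq.comp (Primrec.option_isSome.comp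
        (Code.primrec_evaln.comp (.pair (.pair ?_ ?_) ?_))) (.const true)
      · exact Primrec.snd.comp .snd
      · exact (Primrec.ofNat Code).comp .fst
      · exact Primrec.encode.comp (.pair .fst (Primrec.fst.comp .snd))
    · simp only [Set.mem_ofPred_eq, Part.dom_iff_mem, Code.evaln_complete, Option.isSome_iff_exists,
        Prod.exists, Option.mem_def]
      constructor
      · rintro ⟨l, hl, y, k, h⟩
        exact ⟨l, k, ⟨y, h⟩, hl⟩
      · rintro ⟨l, k, ⟨y, h⟩, hl⟩
        exact ⟨l, hl, y, k, h⟩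
  · rintro ⟨R, L, hR, hL, h⟩
    have hQ : PrimrecRel fun (x : ℕ × List ℕ) (w : ℕ) => R x.1 w ∧ L w = x.2 :=
      PrimrecPred.and (hR.comp (Primrec.fst.comp Primrec.fst) Primrec.snd)
        (Primrec.eq.comp (hL.comp Primrec.snd) (Primrec.snd.comp Primrec.fst))
    -- `c` halts on `(e, l)` when `l` is the demand of a witness for `e ∉ K`; the diagonal is taken
    -- at the code of `c`.
    obtain ⟨c, hc⟩ := Code.exists_code.1 (REPred.exists_nat hQ)
    have hdom : ∀ e l, (c.eval (Encodable.encode (e, l))).Dom ↔ ∃ w, R e w ∧ L w = l := by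
      intro e l
      rw [hc]
      simp [Part.assert]
    have h1 := h (Encodable.encode c)
    simp only [Set.mem_ofPred_eq, Denumerable.ofNat_encode, hdom] at h1
    have h2 : (∃ l : List ℕ, (∀ i ∈ l, i ∈ J) ∧ ∃ w, R (Encodable.encode c) w ∧ L w = l) ↔
        ∃ w, R (Encodable.encode c) w ∧ ∀ i ∈ L w, i ∈ J := by
      constructor
      · rintro ⟨_, hl, w, hw, rfl⟩
        exact ⟨w, hw, hl⟩
      · rintro ⟨w, hw, hl⟩
        exact ⟨_, hl, w, hw, rfl⟩
    rw [h2] at h1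
    exact iff_not_self h1.symm

end REIn

/-! ### Monotonicity and use of oracle computations. -/

/-- The order of partial functions: `g` extends `f`. -/
def Extends (g f : ℕ →. ℕ) : Prop := ∀ n, ∀ v ∈ f n, v ∈ g n

namespace OracleCode

variable {O O' : ℕ →. ℕ} {cf cg : OracleCode} {n y : ℕ}

theorem mem_eval_pair : y ∈ eval O (pair cf cg) n ↔
    ∃ u v, u ∈ eval O cf n ∧ v ∈ eval O cg n ∧ y = Nat.pair u v := by
  simp [eval, Seq.seq, eq_comm]

theorem mem_eval_comp : y ∈ eval O (comp cf cg) n ↔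
    ∃ z, z ∈ eval O cg n ∧ y ∈ eval O cf z := by
  rw [eval]
  exact Part.mem_bind_iff

theorem mem_eval_prec_zero {a : ℕ} :
    y ∈ eval O (prec cf cg) (Nat.pair a 0) ↔ y ∈ eval O cf a := by
  simp [eval]

theorem mem_eval_prec_succ {a : ℕ} :
    y ∈ eval O (prec cf cg) (Nat.pair a (n + 1)) ↔
      ∃ z, z ∈ eval O (prec cf cg) (Nat.pair a n) ∧ y ∈ eval O cg (Nat.pair a (Nat.pair n z)) := by
  simp [eval]

theorem mem_eval_prec {a : ℕ} : y ∈ eval O (prec cf cg) (Nat.pair a n) ↔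
    ∃ c : ℕ → ℕ, c 0 ∈ eval O cf a ∧
      (∀ i < n, c (i + 1) ∈ eval O cg (Nat.pair a (Nat.pair i (c i)))) ∧ c n = y := by
  induction n generalizing y with
  | zero =>
    rw [mem_eval_prec_zero]
    exact ⟨fun h => ⟨fun _ => y, h, by simp, rfl⟩, by rintro ⟨c, h, -, rfl⟩; exact h⟩
  | succ n ih =>
    rw [mem_eval_prec_succ]
    constructor
    · rintro ⟨z, hz, hy⟩
      obtain ⟨c, h0, h1, rfl⟩ := ih.1 hz
      refine ⟨fun i => if i ≤ n then c i else y, by simpa, fun i hi => ?_, by simp⟩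
      rcases Nat.lt_succ_iff_lt_or_eq.1 hi with hi | rfl
      · simpa [hi.le, Nat.succ_le_of_lt hi] using h1 i hi
      · simpa
    · rintro ⟨c, h0, h1, rfl⟩
      exact ⟨c n, ih.2 ⟨c, h0, fun i hi => h1 i (by omega), rfl⟩, h1 n (by omega)⟩

theorem mem_eval_rfind : y ∈ eval O (rfind cf) n ↔
    0 ∈ eval O cf (Nat.pair n y) ∧ ∀ i < y, ∃ m, m ≠ 0 ∧ m ∈ eval O cf (Nat.pair n i) := by
  rw [eval]
  refine Nat.mem_rfind.trans ?_
  simp [and_comm]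

theorem eval_mono (h : Extends O O') (c : OracleCode) : Extends (eval O c) (eval O' c) := by
  induction c with
  | zero | succ | left | right => exact fun _ _ h => h
  | oracle => exact h
  | pair cf cg hf hg =>
    intro n y
    simp only [mem_eval_pair]
    rintro ⟨u, v, hu, hv, rfl⟩
    exact ⟨u, v, hf _ _ hu, hg _ _ hv, rfl⟩
  | comp cf cg hf hg =>
    intro n y
    simp only [mem_eval_comp]
    rintro ⟨z, hz, hy⟩
    exact ⟨z, hg _ _ hz, hf _ _ hy⟩
  | prec cf cg hf hg =>
    intro n y
    rw [← Nat.pair_unpair n]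
    simp only [mem_eval_prec]
    rintro ⟨c, h0, h1, h2⟩
    exact ⟨c, hf _ _ h0, fun i hi => hg _ _ (h1 i hi), h2⟩
  | rfind cf hf =>
    intro n y
    simp only [mem_eval_rfind]
    rintro ⟨h0, h1⟩
    exact ⟨hf _ _ h0, fun i hi => (h1 i hi).imp fun m hm => ⟨hm.1, hf _ _ hm.2⟩⟩

/-- `Q` is the set of oracle queries of the computation of `c` at `n` with oracle `O`. -/
def IsUse (O : ℕ →. ℕ) (c : OracleCode) (n : ℕ) (Q : Finset ℕ) : Prop :=
  (∀ O', (∀ q ∈ Q, ∀ v ∈ O q, v ∈ O' q) → ∀ y ∈ eval O c n, y ∈ eval O' c n) ∧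
    ∀ O', Extends O O' → ∀ y ∈ eval O' c n, ∀ q ∈ Q, (O' q).Dom

theorem isUse_prec {a n : ℕ} (hf : ∀ n y, y ∈ eval O cf n → ∃ Q, IsUse O cf n Q)
    (hg : ∀ n y, y ∈ eval O cg n → ∃ Q, IsUse O cg n Q) :
    ∀ y, y ∈ eval O (prec cf cg) (Nat.pair a n) → ∃ Q, IsUse O (prec cf cg) (Nat.pair a n) Q := by
  classical
  induction n with
  | zero =>
    intro y hy
    simp only [IsUse, mem_eval_prec_zero] at hy ⊢
    exact hf _ _ hy
  | succ n ih =>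
    intro y hy
    obtain ⟨z, hz, hy⟩ := mem_eval_prec_succ.1 hy
    obtain ⟨Q, hQ, hQ'⟩ := ih z hz
    obtain ⟨P, hP, hP'⟩ := hg _ _ hy
    refine ⟨Q ∪ P, fun O' h w hw => ?_, fun O' h w hw q hq => ?_⟩
    · obtain ⟨z', hz', hw⟩ := mem_eval_prec_succ.1 hw
      obtain rfl := Part.mem_unique hz hz'
      exact mem_eval_prec_succ.2 ⟨z, hQ _ (fun q hq => h q (Finset.mem_union_left _ hq)) _ hz,
        hP _ (fun q hq => h q (Finset.mem_union_right _ hq)) _ hw⟩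
    · obtain ⟨z', hz', hw⟩ := mem_eval_prec_succ.1 hw
      obtain rfl := Part.mem_unique hz (eval_mono h _ _ _ hz')
      exact (Finset.mem_union.1 hq).elim (hQ' _ h _ hz' q) (hP' _ h _ hw q)

/-- If a restriction of `O` suffices for a result, its intermediate values agree with those for `O`
by `eval_mono`. So it makes the same queries, and one finite set serves all restrictions at once. -/
theorem exists_isUse (O : ℕ →. ℕ) (c : OracleCode) :
    ∀ n y, y ∈ eval O c n → ∃ Q, IsUse O c n Q := by
  classical
  induction c with
  | zero | succ | left | right => exact fun n _ _ => ⟨∅, fun _ _ _ h => h, by simp⟩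
  | oracle =>
    refine fun n y hy => ⟨{n}, fun O' h v hv => h n (by simp) v hv, fun O' h v hv q hq => ?_⟩
    rw [Finset.mem_singleton.1 hq]
    exact Part.dom_iff_mem.2 ⟨v, hv⟩
  | pair cf cg hf hg =>
    intro n y hy
    obtain ⟨u, v, hu, hv, rfl⟩ := mem_eval_pair.1 hy
    obtain ⟨Q, hQ, hQ'⟩ := hf _ _ hu
    obtain ⟨P, hP, hP'⟩ := hg _ _ hv
    refine ⟨Q ∪ P, fun O' h w hw => ?_, fun O' h w hw q hq => ?_⟩
    · obtain ⟨u, v, hu, hv, hw⟩ := mem_eval_pair.1 hw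
      exact mem_eval_pair.2 ⟨u, v, hQ _ (fun q hq => h q (Finset.mem_union_left _ hq)) _ hu,
        hP _ (fun q hq => h q (Finset.mem_union_right _ hq)) _ hv, hw⟩
    · obtain ⟨u, v, hu, hv, hw⟩ := mem_eval_pair.1 hw
      exact (Finset.mem_union.1 hq).elim (hQ' _ h _ hu q) (hP' _ h _ hv q)
  | comp cf cg hf hg =>
    intro n y hy
    obtain ⟨z, hz, hy⟩ := mem_eval_comp.1 hy
    obtain ⟨Q, hQ, hQ'⟩ := hg _ _ hz
    obtain ⟨P, hP, hP'⟩ := hf _ _ hy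
    refine ⟨Q ∪ P, fun O' h w hw => ?_, fun O' h w hw q hq => ?_⟩
    · obtain ⟨z', hz', hw⟩ := mem_eval_comp.1 hw
      obtain rfl := Part.mem_unique hz hz'
      exact mem_eval_comp.2 ⟨z, hQ _ (fun q hq => h q (Finset.mem_union_left _ hq)) _ hz,
        hP _ (fun q hq => h q (Finset.mem_union_right _ hq)) _ hw⟩
    · obtain ⟨z', hz', hw⟩ := mem_eval_comp.1 hw
      obtain rfl := Part.mem_unique hz (eval_mono h _ _ _ hz')
      exact (Finset.mem_union.1 hq).elim (hQ' _ h _ hz' q) (hP' _ h _ hw q)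
  | prec cf cg hf hg =>
    intro n
    rw [← Nat.pair_unpair n]
    exact isUse_prec hf hg
  | rfind cf hf =>
    intro n y hy
    have hdom : ∀ i ≤ y, ∃ m, m ∈ eval O cf (Nat.pair n i) := fun i hi =>
      hi.eq_or_lt.elim (fun h => ⟨0, h ▸ (mem_eval_rfind.1 hy).1⟩)
        fun h => ((mem_eval_rfind.1 hy).2 i h).imp fun _ => And.right
    choose! Q hQ hQ' using fun i hi => hf (Nat.pair n i) _ (hdom i hi).choose_spec
    have huniq : ∀ {z}, z ∈ eval O (rfind cf) n → z = y := fun h => Part.mem_unique h hy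
    -- The search evaluates every `i ≤ y`, including the successful one.
    refine ⟨(Finset.range (y + 1)).biUnion Q, fun O' h w hw => ?_, fun O' h w hw q hq => ?_⟩
    · obtain rfl := huniq hw
      have h' : ∀ i ≤ w, ∀ m ∈ eval O cf (Nat.pair n i), m ∈ eval O' cf (Nat.pair n i) :=
        fun i hi => hQ i hi O' fun q hq =>
          h q (Finset.mem_biUnion.2 ⟨i, Finset.mem_range.2 (by omega), hq⟩)
      refine mem_eval_rfind.2 ⟨h' w le_rfl _ (mem_eval_rfind.1 hw).1, fun i hi => ?_⟩
      exact ((mem_eval_rfind.1 hw).2 i hi).imp fun m hm => ⟨hm.1, h' i hi.le _ hm.2⟩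
    · obtain rfl := huniq (eval_mono h _ _ _ hw)
      obtain ⟨i, hi, hq⟩ := Finset.mem_biUnion.1 hq
      have hi : i ≤ w := by simpa [Nat.lt_succ_iff] using hi
      obtain ⟨m, hm⟩ : ∃ m, m ∈ eval O' cf (Nat.pair n i) :=
        hi.eq_or_lt.elim (fun h => ⟨0, h ▸ (mem_eval_rfind.1 hw).1⟩)
          fun h => ((mem_eval_rfind.1 hw).2 i h).imp fun _ => And.right
      exact hQ' i hi O' h m hm q hq

end OracleCode

/-! ### Monotonicity and stability of Van Oosten's application. -/

open OracleCode

theorem mem_vanOostenApp {f g : ℕ →. ℕ} {n y : ℕ} : y ∈ vanOostenApp f g n ↔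
    ∃ e ∈ f 0, y ∈ eval (funJoin f g) (ofNatCode e) n := by
  simp [vanOostenApp, oraclePhi]

theorem mem_funJoin {f g : ℕ →. ℕ} {q v : ℕ} : v ∈ funJoin f g q ↔
    (q % 2 = 0 ∧ v ∈ f (q / 2)) ∨ (q % 2 = 1 ∧ v ∈ g (q / 2)) := by
  rcases Nat.mod_two_eq_zero_or_one q with h | h <;> simp [funJoin, h]

theorem funJoin_mono {f g f' g' : ℕ →. ℕ} (hf : Extends f f') (hg : Extends g g') :
    Extends (funJoin f g) (funJoin f' g') := fun q v => by
  simp only [mem_funJoin]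
  exact Or.imp (And.imp_right (hf _ _)) (And.imp_right (hg _ _))

theorem vanOostenApp_mono {f g f' g' : ℕ →. ℕ} (hf : Extends f f') (hg : Extends g g') :
    Extends (vanOostenApp f g) (vanOostenApp f' g') := fun n y => by
  simp only [mem_vanOostenApp]
  rintro ⟨e, he, hy⟩
  exact ⟨e, hf _ _ he, eval_mono (funJoin_mono hf hg) _ _ _ hy⟩

/-- Stability of the application of van Oosten's model: of two compatible computations with the
same result, the arguments can be mixed. -/
theorem mem_vanOostenApp_of_extends {h f f' g g' : ℕ →. ℕ} (hf : Extends h f) (hf' : Extends h f')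
    (hg : Extends h g) (hg' : Extends h g') {n y y' : ℕ} (hy : y ∈ vanOostenApp f g n)
    (hy' : y' ∈ vanOostenApp f' g' n) : y ∈ vanOostenApp f g' n := by
  obtain ⟨e, he, hy⟩ := mem_vanOostenApp.1 hy
  obtain ⟨e', he', hy'⟩ := mem_vanOostenApp.1 hy'
  obtain rfl := Part.mem_unique (hf _ _ he) (hf' _ _ he')
  -- Both computations restrict the one with oracle `funJoin h h`, so both oracles are defined on
  -- its use.
  have hyh := eval_mono (funJoin_mono hf hg) _ _ _ hy
  obtain ⟨Q, hQ, hQ'⟩ := exists_isUse _ _ _ _ hyh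
  have hd := hQ' _ (funJoin_mono hf hg) _ hy
  have hd' := hQ' _ (funJoin_mono hf' hg') _ hy'
  refine mem_vanOostenApp.2 ⟨e, he, hQ _ (fun q hq v hv => ?_) _ hyh⟩
  obtain ⟨w, hw⟩ := Part.dom_iff_mem.1 (hd q hq)
  obtain ⟨w', hw'⟩ := Part.dom_iff_mem.1 (hd' q hq)
  have h1 := Part.mem_unique hv (funJoin_mono hf hg _ _ hw)
  have h2 := Part.mem_unique hv (funJoin_mono hf' hg' _ _ hw')
  subst h1 h2
  rw [mem_funJoin] at hw hw' ⊢
  -- Even queries are answered by `f` from the first oracle, odd ones by `g'` from the second.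
  rcases hw with hw | hw
  · exact .inl hw
  · refine .inr (hw'.resolve_left ?_)
    omega

/-! ### Enumerating graphs of oracle computations. -/

namespace REIn

variable {J : Set ℕ} {α : Type*} [Primcodable α]

/-- A result depends only on positive information about the graph of the oracle. Even minimization
does: earlier values are required to exist and be nonzero. -/
theorem eval {O : α → ℕ →. ℕ} (hO : REIn J fun x : α × ℕ × ℕ => x.2.2 ∈ O x.1 x.2.1)
    (c : OracleCode) : REIn J fun x : α × ℕ × ℕ => x.2.2 ∈ eval (O x.1) c x.2.1 := by
  have htot : ∀ {f : ℕ → ℕ}, Primrec f →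
      REIn J fun x : α × ℕ × ℕ => x.2.2 ∈ (Part.some (f x.2.1) : Part ℕ) := fun hf =>
    (of_primrecPred (p := fun x : α × ℕ × ℕ => x.2.2 = _) (Primrec.eq.comp
      (Primrec.snd.comp .snd) (hf.comp (Primrec.fst.comp .snd)))).of_eq fun x => by simp
  induction c with
  | zero => exact htot (.const 0)
  | succ => exact htot .succ
  | left => exact htot (Primrec.fst.comp .unpair)
  | right => exact htot (Primrec.snd.comp .unpair)
  | oracle => exact hO
  | pair cf cg hf hg =>
    simp only [mem_eval_pair]
    refine exists' (exists' (.and (hf.comp (f := fun y : ((α × ℕ × ℕ) × ℕ) × ℕ =>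
      (y.1.1.1, y.1.1.2.1, y.1.2)) ?_) (.and (hg.comp (f := fun y : ((α × ℕ × ℕ) × ℕ) × ℕ =>
      (y.1.1.1, y.1.1.2.1, y.2)) ?_) (of_primrecPred (Primrec.eq.comp ?_ ?_)))))
    · exact (Primrec.fst.comp (Primrec.fst.comp .fst)).pair ((Primrec.fst.comp (Primrec.snd.comp
        (Primrec.fst.comp .fst))).pair (Primrec.snd.comp .fst))
    · exact (Primrec.fst.comp (Primrec.fst.comp .fst)).pair ((Primrec.fst.comp (Primrec.snd.comp
        (Primrec.fst.comp .fst))).pair .snd)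
    · exact Primrec.snd.comp (Primrec.snd.comp (Primrec.fst.comp .fst))
    · exact Primrec₂.natPair.comp (Primrec.snd.comp .fst) .snd
  | comp cf cg hf hg =>
    simp only [mem_eval_comp]
    refine exists' (.and (hg.comp (f := fun y : (α × ℕ × ℕ) × ℕ =>
      (y.1.1, y.1.2.1, y.2)) ?_) (hf.comp (f := fun y : (α × ℕ × ℕ) × ℕ =>
      (y.1.1, y.2, y.1.2.2)) ?_))
    · exact (Primrec.fst.comp .fst).pair
        ((Primrec.fst.comp (Primrec.snd.comp .fst)).pair .snd)
    · exact (Primrec.fst.comp .fst).pair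
        (Primrec.snd.pair (Primrec.snd.comp (Primrec.snd.comp .fst)))
  | prec cf cg hf hg =>
    have h := chain (J := J) (α := α × ℕ) (β := ℕ)
      (base := fun x b => b ∈ OracleCode.eval (O x.1) cf x.2)
      (step := fun x i b b' => b' ∈ OracleCode.eval (O x.1) cg (Nat.pair x.2 (Nat.pair i b)))
      (hf.comp (f := fun y : (α × ℕ) × ℕ => (y.1.1, y.1.2, y.2)) ?_)
      (hg.comp (f := fun y : (α × ℕ) × ℕ × ℕ × ℕ =>
        (y.1.1, Nat.pair y.1.2 (Nat.pair y.2.1 y.2.2.1), y.2.2.2)) ?_)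
    · refine (h.comp (f := fun x : α × ℕ × ℕ =>
        ((x.1, x.2.1.unpair.1), x.2.1.unpair.2, x.2.2)) ?_).of_eq fun x => ?_
      · have hu : Primrec fun x : α × ℕ × ℕ => x.2.1.unpair :=
          Primrec.unpair.comp (Primrec.fst.comp .snd)
        exact (Primrec.fst.pair (Primrec.fst.comp hu)).pair
          ((Primrec.snd.comp hu).pair (Primrec.snd.comp .snd))
      · conv_rhs => rw [← Nat.pair_unpair x.2.1, mem_eval_prec]
    · exact (Primrec.fst.comp .fst).pair ((Primrec.snd.comp .fst).pair .snd)
    · exact (Primrec.fst.comp .fst).pair ((Primrec₂.natPair.comp (Primrec.snd.comp .fst)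
        (Primrec₂.natPair.comp (Primrec.fst.comp .snd)
          (Primrec.fst.comp (Primrec.snd.comp .snd)))).pair
        (Primrec.snd.comp (Primrec.snd.comp .snd)))
  | rfind cf hf =>
    simp only [mem_eval_rfind]
    refine .and (hf.comp (f := fun x : α × ℕ × ℕ => (x.1, Nat.pair x.2.1 x.2.2, 0)) ?_)
      (forall_lt (exists' (.and (of_primrecPred (PrimrecPred.not (Primrec.eq.comp .snd (.const 0))))
        (hf.comp (f := fun y : ((α × ℕ × ℕ) × ℕ) × ℕ =>
          (y.1.1.1, Nat.pair y.1.1.2.1 y.1.2, y.2)) ?_))) (Primrec.snd.comp .snd))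
    · exact Primrec.fst.pair ((Primrec₂.natPair.comp (Primrec.fst.comp .snd)
        (Primrec.snd.comp .snd)).pair (.const 0))
    · exact (Primrec.fst.comp (Primrec.fst.comp .fst)).pair ((Primrec₂.natPair.comp
        (Primrec.fst.comp (Primrec.snd.comp (Primrec.fst.comp .fst)))
        (Primrec.snd.comp .fst)).pair .snd)

end REIn

/-- The value `0` needs positive information on the complement of `X`, which is why the join with
the complement appears. -/
theorem reIn_charFun (X : Set ℕ) :
    REIn (setJoin X Xᶜ) fun x : ℕ × ℕ => x.2 ∈ charFun X x.1 := by
  have h0 : ∀ {f : ℕ × ℕ → ℕ} (b : ℕ), Primrec f →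
      REIn (setJoin X Xᶜ) fun x : ℕ × ℕ => x.2 = b ∧ f x ∈ setJoin X Xᶜ := fun b hf =>
    .and (.of_primrecPred (Primrec.eq.comp .snd (.const b))) (REIn.oracle.comp hf)
  have hmul : Primrec fun x : ℕ × ℕ => 2 * x.1 := Primrec.nat_mul.comp (.const 2) .fst
  refine ((h0 1 hmul).or (h0 0 (Primrec.succ.comp hmul))).of_eq fun ⟨q, v⟩ => ?_
  have h1 : 2 * q ∈ setJoin X Xᶜ ↔ q ∈ X := by
    constructor
    · rintro (⟨n, hn, h⟩ | ⟨n, hn, h⟩)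
      · rwa [show q = n by omega]
      · omega
    · exact fun h => .inl ⟨q, h, rfl⟩
  have h2 : (2 * q).succ ∈ setJoin X Xᶜ ↔ q ∉ X := by
    constructor
    · rintro (⟨n, hn, h⟩ | ⟨n, hn, h⟩)
      · omega
      · rwa [show q = n by omega]
    · exact fun h => .inr ⟨q, h, rfl⟩
  simp only [h1, h2, charFun]
  by_cases hq : q ∈ X <;> simp [hq]

theorem reIn_of_mem_partialComputableIn {X : Set ℕ} {f : ℕ →. ℕ}
    (hf : f ∈ partialComputableIn X) :
    REIn (setJoin X Xᶜ) fun x : ℕ × ℕ => x.2 ∈ f x.1 := by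
  obtain ⟨c, rfl⟩ := (exists_eval_eq_iff _ _).2 hf
  exact (REIn.eval (α := Unit) (O := fun _ => charFun X)
    ((reIn_charFun X).comp .snd) c).comp (f := fun x : ℕ × ℕ => ((), x)) (.pair (.const ()) .id)

/-! ### Finite approximations and continuity of application. -/

/-- The finite partial function with the given list of values. -/
def listFun (l : List (Option ℕ)) : ℕ →. ℕ := fun q => ((l[q]?).join : Option ℕ)

theorem mem_listFun {l : List (Option ℕ)} {q v : ℕ} : v ∈ listFun l q ↔ l[q]? = some (some v) := by
  simp [listFun, Option.join_eq_some_iff]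

open Classical in
/-- The restriction of a partial function to the numbers below `N`, as a list of values. -/
noncomputable def truncation (g : ℕ →. ℕ) (N : ℕ) : List (Option ℕ) :=
  (List.range N).map fun q => (g q).toOption

theorem mem_listFun_truncation {g : ℕ →. ℕ} {N q v : ℕ} :
    v ∈ listFun (truncation g N) q ↔ q < N ∧ v ∈ g q := by
  classical
  rw [mem_listFun, truncation, List.getElem?_map]
  by_cases h : q < N
  · simp [h]
  · simp [h]

theorem extends_listFun_truncation (g : ℕ →. ℕ) (N : ℕ) : Extends g (listFun (truncation g N)) :=
  fun _ _ h => (mem_listFun_truncation.1 h).2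

/-- Continuity, from finiteness of the use. The bound is uniform in `M ≥ N` so that bounds for
finitely many arguments can be combined. -/
theorem exists_mem_vanOostenApp_truncation {f g : ℕ →. ℕ} {n y : ℕ}
    (hy : y ∈ vanOostenApp f g n) :
    ∃ N, ∀ M ≥ N, y ∈ vanOostenApp f (listFun (truncation g M)) n := by
  obtain ⟨e, he, hy⟩ := mem_vanOostenApp.1 hy
  obtain ⟨Q, hQ, -⟩ := exists_isUse _ _ _ _ hy
  -- A query `q` reaches `g` at `q / 2 ≤ q`, so this bound suffices.
  refine ⟨Q.sup id + 1, fun M hM => mem_vanOostenApp.2 ⟨e, he, hQ _ (fun q hq v hv => ?_) _ hy⟩⟩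
  have hqM : q ≤ Q.sup id := Finset.le_sup (f := id) hq
  rw [mem_funJoin] at hv ⊢
  refine hv.imp id fun hv => ⟨hv.1, mem_listFun_truncation.2 ⟨by omega, hv.2⟩⟩

theorem exists_extends_vanOostenApp_truncation (f g : ℕ →. ℕ) (N : ℕ) :
    ∃ M, Extends (vanOostenApp f (listFun (truncation g M)))
      (listFun (truncation (vanOostenApp f g) N)) := by
  have h : ∀ q, ∃ M, ∀ M' ≥ M, ∀ v ∈ vanOostenApp f g q,
      v ∈ vanOostenApp f (listFun (truncation g M')) q := by
    intro q
    by_cases hd : (vanOostenApp f g q).Dom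
    · obtain ⟨y, hy⟩ := Part.dom_iff_mem.1 hd
      obtain ⟨M, hM⟩ := exists_mem_vanOostenApp_truncation hy
      exact ⟨M, fun M' hM' v hv => Part.mem_unique hy hv ▸ hM M' hM'⟩
    · exact ⟨0, fun _ _ v hv => absurd (Part.dom_iff_mem.2 ⟨v, hv⟩) hd⟩
  choose M hM using h
  refine ⟨(Finset.range N).sup M, fun q v hv => ?_⟩
  obtain ⟨hq, hv⟩ := mem_listFun_truncation.1 hv
  exact hM q _ (Finset.le_sup (Finset.mem_range.2 hq)) v hv

/-- The chain is found from the top down: `N` dictates the truncation needed one application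
earlier, hence the induction for all `N`. -/
theorem exists_chain_truncation (s k : ℕ →. ℕ) (e N : ℕ) :
    ∃ c : ℕ → List (Option ℕ), Extends k (listFun (c 0)) ∧
      (∀ i < e, Extends (vanOostenApp s (listFun (c i))) (listFun (c (i + 1)))) ∧
      c e = truncation ((vanOostenApp s)^[e] k) N := by
  induction e generalizing N with
  | zero => exact ⟨fun _ => truncation k N, extends_listFun_truncation k N, by simp, rfl⟩
  | succ e ih =>
    obtain ⟨M, hM⟩ := exists_extends_vanOostenApp_truncation s ((vanOostenApp s)^[e] k) N
    obtain ⟨c, h0, h1, h2⟩ := ih M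
    refine ⟨fun i => if i ≤ e then c i else truncation ((vanOostenApp s)^[e + 1] k) N,
      by simpa, fun i hi => ?_, by simp⟩
    rcases Nat.lt_succ_iff_lt_or_eq.1 hi with hi | rfl
    · simpa [hi.le, Nat.succ_le_of_lt hi] using h1 i hi
    · simpa [h2, Function.iterate_succ_apply'] using hM

theorem extends_of_chain {s k : ℕ →. ℕ} {c : ℕ → List (Option ℕ)} {e : ℕ}
    (h0 : Extends k (listFun (c 0)))
    (h1 : ∀ i < e, Extends (vanOostenApp s (listFun (c i))) (listFun (c (i + 1)))) :
    Extends ((vanOostenApp s)^[e] k) (listFun (c e)) := by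
  induction e with
  | zero => exact h0
  | succ e ih =>
    rw [Function.iterate_succ_apply']
    exact fun q v hv => vanOostenApp_mono (fun _ _ h => h) (ih fun i hi => h1 i (by omega)) _ _
      (h1 e (by omega) _ _ hv)

/-- The iterate is an infinite object; a chain of finite approximations replaces it by data that can
be enumerated. -/
theorem mem_vanOostenApp_iterate {t s k : ℕ →. ℕ} {e m y : ℕ} :
    y ∈ vanOostenApp t ((vanOostenApp s)^[e] k) m ↔
      ∃ l, (∃ c : ℕ → List (Option ℕ), Extends k (listFun (c 0)) ∧
        (∀ i < e, Extends (vanOostenApp s (listFun (c i))) (listFun (c (i + 1)))) ∧ c e = l) ∧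
        y ∈ vanOostenApp t (listFun l) m := by
  constructor
  · intro h
    obtain ⟨N, hN⟩ := exists_mem_vanOostenApp_truncation h
    exact ⟨_, exists_chain_truncation s k e N, hN N le_rfl⟩
  · rintro ⟨_, ⟨c, h0, h1, rfl⟩, hy⟩
    exact vanOostenApp_mono (fun _ _ h => h) (extends_of_chain h0 h1) _ _ hy

/-! ### Enumerating iterated applications. -/

section

variable {J : Set ℕ}

theorem reIn_extends_listFun {α : Type*} [Primcodable α] {O : α → ℕ →. ℕ}
    (hO : REIn J fun x : α × ℕ × ℕ => x.2.2 ∈ O x.1 x.2.1) :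
    REIn J fun x : α × List (Option ℕ) => Extends (O x.1) (listFun x.2) := by
  have hget : Primrec fun y : (α × List (Option ℕ)) × ℕ => y.1.2[y.2]? :=
    Primrec.list_getElem?.comp (Primrec.snd.comp .fst) .snd
  have h : REIn J fun x : α × List (Option ℕ) => ∀ q < x.2.length,
      x.2[q]? = some none ∨ ∃ v, x.2[q]? = some (some v) ∧ v ∈ O x.1 q := by
    refine .forall_lt (.or (.of_primrecPred (Primrec.eq.comp hget (.const _))) (.exists' (.and
      (.of_primrecPred (Primrec.eq.comp (hget.comp .fst) ?_)) (hO.comp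
        (f := fun y : ((α × List (Option ℕ)) × ℕ) × ℕ => (y.1.1.1, y.1.2, y.2)) ?_))))
      (Primrec.list_length.comp .snd)
    · exact Primrec.option_some.comp (Primrec.option_some.comp .snd)
    · exact (Primrec.fst.comp (Primrec.fst.comp .fst)).pair ((Primrec.snd.comp .fst).pair .snd)
  refine h.of_eq fun x => ⟨fun h q v hv => ?_, fun h q hq => ?_⟩
  · rw [mem_listFun] at hv
    have hq : q < x.2.length := (List.getElem?_eq_some_iff.1 hv).1
    rcases h q hq with h | ⟨w, hw, h⟩ <;> simp_all
  · rcases hv : x.2[q] with _ | v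
    · exact .inl (by rw [List.getElem?_eq_getElem hq, hv])
    · have hv' : x.2[q]? = some (some v) := by rw [List.getElem?_eq_getElem hq, hv]
      exact .inr ⟨v, hv', h q v (mem_listFun.2 hv')⟩

theorem reIn_vanOostenApp_listFun {f : ℕ →. ℕ} (hf : REIn J fun x : ℕ × ℕ => x.2 ∈ f x.1) :
    REIn J fun x : List (Option ℕ) × ℕ × ℕ => x.2.2 ∈ vanOostenApp f (listFun x.1) x.2.1 := by
  have hq : Primrec fun x : List (Option ℕ) × ℕ × ℕ => x.2.1 := Primrec.fst.comp .snd
  have hdiv : Primrec fun x : List (Option ℕ) × ℕ × ℕ => x.2.1 / 2 :=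
    Primrec.nat_div.comp hq (.const 2)
  have hmod : ∀ b, PrimrecPred fun x : List (Option ℕ) × ℕ × ℕ => x.2.1 % 2 = b := fun b =>
    Primrec.eq.comp (Primrec.nat_mod.comp hq (.const 2)) (.const b)
  have hjoin : REIn J fun x : List (Option ℕ) × ℕ × ℕ => x.2.2 ∈ funJoin f (listFun x.1) x.2.1 := by
    simp only [mem_funJoin, mem_listFun]
    refine .or (.and (.of_primrecPred (hmod 0)) (hf.comp (hdiv.pair (Primrec.snd.comp .snd))))
      (.and (.of_primrecPred (hmod 1)) (.of_primrecPred (Primrec.eq.comp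
        (Primrec.list_getElem?.comp .fst hdiv) ?_)))
    exact Primrec.option_some.comp (Primrec.option_some.comp (Primrec.snd.comp .snd))
  simp only [mem_vanOostenApp]
  -- The program `f 0` does not depend on the list, so it may be fixed non-uniformly.
  by_cases hd : (f 0).Dom
  · obtain ⟨e, he⟩ := Part.dom_iff_mem.1 hd
    refine (REIn.eval (O := fun l => funJoin f (listFun l)) hjoin (ofNatCode e)).of_eq fun x => ⟨fun h => ⟨e, he, h⟩, ?_⟩
    rintro ⟨e', he', h⟩
    rwa [Part.mem_unique he he']
  · refine (REIn.of_primrecPred (p := fun _ => 0 = 1)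
      (Primrec.eq.comp (.const 0) (.const 1))).of_eq fun x => ?_
    simp only [zero_ne_one, false_iff]
    rintro ⟨e, he, -⟩
    exact hd (Part.dom_iff_mem.2 ⟨e, he⟩)

theorem reIn_vanOostenApp_iterate {t s k : ℕ →. ℕ} (ht : REIn J fun x : ℕ × ℕ => x.2 ∈ t x.1)
    (hs : REIn J fun x : ℕ × ℕ => x.2 ∈ s x.1) (hk : REIn J fun x : ℕ × ℕ => x.2 ∈ k x.1)
    (m y : ℕ) : REIn J fun e => y ∈ vanOostenApp t ((vanOostenApp s)^[e] k) m := by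
  simp only [mem_vanOostenApp_iterate]
  have hbase := reIn_extends_listFun (O := fun _ : Unit => k) (hk.comp .snd)
  have hstep := reIn_extends_listFun (O := fun l => vanOostenApp s (listFun l))
    (reIn_vanOostenApp_listFun hs)
  have hchain := REIn.chain (base := fun _ l => Extends k (listFun l)) hbase (step := fun _ _ l l' =>
    Extends (vanOostenApp s (listFun l)) (listFun l')) (hstep.comp
      (f := fun x : Unit × ℕ × List (Option ℕ) × List (Option ℕ) => x.2.2)
      (Primrec.snd.comp .snd))
  refine .exists' (.and (hchain.comp (f := fun x : ℕ × List (Option ℕ) => ((), x))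
    (.pair (.const ()) .id)) ((reIn_vanOostenApp_listFun ht).comp
    (f := fun x : ℕ × List (Option ℕ) => (x.2, m, y)) (.pair .snd (.const _))))

end

/-! ### Monotonicity of an embedding and the contradiction with stability. -/

/-- The element of the graph model that sends `Y` to `{n | P n ∨ (Q n ∧ h n ∈ Y)}`. -/
def thresholdSet (P Q : ℕ → Prop) (h : ℕ → ℕ) : Set ℕ :=
  {x | P x.unpair.1 ∨ (Q x.unpair.1 ∧ h x.unpair.1 ∈ Finset.equivBitIndices x.unpair.2)}

theorem graphApp_thresholdSet (P Q : ℕ → Prop) (h : ℕ → ℕ) (Y : Set ℕ) :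
    graphApp (thresholdSet P Q h) Y = {n | P n ∨ (Q n ∧ h n ∈ Y)} := by
  ext n
  simp only [graphApp, thresholdSet, Set.mem_ofPred_eq, Nat.unpair_pair]
  constructor
  · rintro ⟨u, hn, hu⟩
    exact hn.imp_right fun hn => ⟨hn.1, hu _ hn.2⟩
  · rintro (hn | ⟨hn, hY⟩)
    · refine ⟨Finset.equivBitIndices.symm ∅, .inl hn, fun i hi => ?_⟩
      rw [Equiv.apply_symm_apply] at hi
      simp at hi
    · refine ⟨Finset.equivBitIndices.symm {h n}, .inr ⟨hn, ?_⟩, fun i hi => ?_⟩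
      · rw [Equiv.apply_symm_apply]
        simp
      · rw [Equiv.apply_symm_apply, Finset.mem_singleton] at hi
        rwa [hi]

theorem primrecPred_mem_thresholdSet {P Q : ℕ → Prop} {h : ℕ → ℕ} (hP : PrimrecPred P)
    (hQ : PrimrecPred Q) (hh : Primrec h) : PrimrecPred fun n => n ∈ thresholdSet P Q h :=
  have h1 : Primrec fun x : ℕ => x.unpair.1 := Primrec.fst.comp .unpair
  (hP.comp h1).or ((hQ.comp h1).and
    (primrecRel_mem_equivBitIndices.comp (hh.comp h1) (Primrec.snd.comp .unpair)))

/-- The properties of a weak embedding of `𝓖^J` into `𝓑^X`, for a map on all sets. -/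
structure IsEmbeddingOn (J X : Set ℕ) (f : Set ℕ → ℕ →. ℕ) : Prop where
  computable : ∀ U, GraphGenerated J U → f U ∈ partialComputableIn X
  app : ∀ U V, GraphGenerated J U → GraphGenerated J V →
    f (graphApp U V) = vanOostenApp (f U) (f V)
  inj : ∀ U V, GraphGenerated J U → GraphGenerated J V → f U = f V → U = V

theorem primrecPred_false {α : Type*} [Primcodable α] : PrimrecPred fun _ : α => False :=
  (Primrec.eq.comp (.const 0) (.const 1)).of_eq fun _ => by simp

theorem primrecPred_true {α : Type*} [Primcodable α] : PrimrecPred fun _ : α => True :=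
  (Primrec.eq.comp (.const 0) (.const 0)).of_eq fun _ => by simp

theorem graphGenerated_of_primrecPred {J U : Set ℕ} (hU : PrimrecPred fun n => n ∈ U) :
    GraphGenerated J U :=
  .ce U hU.rePred

namespace IsEmbeddingOn

variable {X : Set ℕ} {f : Set ℕ → ℕ →. ℕ}

/-- The map is monotone, by the argument of the theorem of Myhill and Shepherdson. -/
theorem mono (hf : IsEmbeddingOn (setJoin X Xᶜ) X f) {U V : Set ℕ}
    (hU : PrimrecPred fun n => n ∈ U) (hV : PrimrecPred fun n => n ∈ V) (hUV : U ⊆ V) :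
    Extends (f V) (f U) := by
  obtain ⟨K, hK, hK'⟩ := REIn.exists_not_compl (setJoin X Xᶜ)
  intro m y hy
  by_contra hy'
  refine hK' ?_
  -- `S` sends `Y` to `{n | n + 1 ∈ Y}`. As `U ⊆ V`, `T` sends `Y` to `V` if `0 ∈ Y` and to `U`
  -- otherwise.
  let S := thresholdSet (fun _ => False) (fun _ => True) Nat.succ
  let T := thresholdSet (fun n => n ∈ U) (fun n => n ∈ V) fun _ => 0
  have hS : GraphGenerated (setJoin X Xᶜ) S := graphGenerated_of_primrecPred
    (primrecPred_mem_thresholdSet primrecPred_false primrecPred_true .succ)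
  have hT : GraphGenerated (setJoin X Xᶜ) T := graphGenerated_of_primrecPred
    (primrecPred_mem_thresholdSet hU hV (.const 0))
  have hshift : ∀ e, GraphGenerated (setJoin X Xᶜ) {n | n + e ∈ K} ∧
      f {n | n + e ∈ K} = (vanOostenApp (f S))^[e] (f K) := by
    intro e
    induction e with
    | zero => exact ⟨hK.graphGenerated, rfl⟩
    | succ e ih =>
      have h : {n | n + (e + 1) ∈ K} = graphApp S {n | n + e ∈ K} := by
        rw [graphApp_thresholdSet]
        ext n
        simp [show n + 1 + e = n + (e + 1) by omega]
      rw [h, hf.app _ _ hS ih.1, ih.2, Function.iterate_succ_apply']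
      exact ⟨.app _ _ hS ih.1, rfl⟩
  refine (reIn_vanOostenApp_iterate
    (reIn_of_mem_partialComputableIn (hf.computable T hT))
    (reIn_of_mem_partialComputableIn (hf.computable S hS))
    (reIn_of_mem_partialComputableIn (hf.computable K hK.graphGenerated)) m y).of_eq fun e => ?_
  rw [← (hshift e).2, ← hf.app _ _ hT (hshift e).1, graphApp_thresholdSet]
  by_cases he : e ∈ K
  · have h : {n | n ∈ U ∨ (n ∈ V ∧ 0 ∈ {n | n + e ∈ K})} = V := by
      ext n
      simpa [he] using @hUV n
    rw [h]
    simp [he, hy']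
  · have h : {n | n ∈ U ∨ (n ∈ V ∧ 0 ∈ {n | n + e ∈ K})} = U := by
      ext n
      simp [he]
    rw [h]
    simp [he, hy]

end IsEmbeddingOn

theorem not_isEmbeddingOn (X : Set ℕ) (f : Set ℕ → ℕ →. ℕ) :
    ¬ IsEmbeddingOn (setJoin X Xᶜ) X f := by
  intro hf
  let A : ℕ → Set ℕ := fun i => thresholdSet (fun _ => False) (fun n => n = 0) fun _ => i
  have hA : ∀ i, PrimrecPred fun n => n ∈ A i := fun i =>
    primrecPred_mem_thresholdSet primrecPred_false (Primrec.eq.comp .id (.const 0)) (.const i)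
  have hsing : ∀ i, PrimrecPred fun n : ℕ => n ∈ ({i} : Set ℕ) := fun i =>
    Primrec.eq.comp .id (.const i)
  have hempty : PrimrecPred fun n : ℕ => n ∈ (∅ : Set ℕ) := primrecPred_false
  have htop : ∀ {U : Set ℕ}, PrimrecPred (fun n => n ∈ U) → Extends (f Set.univ) (f U) :=
    fun hU => hf.mono hU primrecPred_true (Set.subset_univ _)
  have happ : ∀ i j, vanOostenApp (f (A i)) (f {j}) = f {n | n = 0 ∧ i = j} := fun i j => by
    rw [← hf.app _ _ (graphGenerated_of_primrecPred (hA i))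
      (graphGenerated_of_primrecPred (hsing j)), graphApp_thresholdSet]
    simp
  have h11 := happ 1 1
  have h22 := happ 2 2
  have h12 := happ 1 2
  simp only [and_true, OfNat.one_ne_ofNat, and_false] at h11 h22 h12
  -- Mixing the program `f (A 1)` with the argument `f {2}` keeps the common value, although `A 1 ·
  -- {2}` is empty.
  have hle : Extends (f ∅) (f {0}) := by
    intro n y hy
    have h := mem_vanOostenApp_of_extends (htop (hA 1)) (htop (hA 2)) (htop (hsing 1))
      (htop (hsing 2)) (h11 ▸ hy) (h22 ▸ hy)
    rwa [h12] at h
  have hge : Extends (f {0}) (f ∅) := hf.mono hempty (hsing 0) (Set.empty_subset _)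
  have heq : f ∅ = f {0} := funext fun n => Part.ext fun y => ⟨hge n y, hle n y⟩
  exact Set.singleton_ne_empty 0 (hf.inj _ _ (graphGenerated_of_primrecPred hempty)
    (graphGenerated_of_primrecPred (hsing 0)) heq).symm

theorem mainTheorem4 (X : Set ℕ) :
    IsEmpty (PAS.WeakEmbedding (graphModelRel (setJoin X Xᶜ)) (vanOostenModelRel X)) := by
  classical
  refine ⟨fun F => ?_⟩
  let G (U : Set ℕ) (hU : GraphGenerated (setJoin X Xᶜ) U) : ℕ →. ℕ := (F.toFun ⟨U, hU⟩).1
  -- The value outside the model is arbitrary; `IsEmbeddingOn` speaks only of generated sets.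
  let f (U : Set ℕ) : ℕ →. ℕ :=
    if hU : GraphGenerated (setJoin X Xᶜ) U then G U hU else fun _ => Part.none
  have hG : ∀ U hU, f U = G U hU := fun U hU => dif_pos hU
  refine not_isEmbeddingOn X f ⟨fun U hU => ?_, fun U V hU hV => ?_, fun U V hU hV h => ?_⟩
  · rw [hG U hU]
    exact (F.toFun ⟨U, hU⟩).2
  · have hUV := GraphGenerated.app U V hU hV
    rw [hG U hU, hG V hV, hG _ hUV]
    obtain ⟨_, h⟩ := F.map_app ⟨U, hU⟩ ⟨V, hV⟩ ⟨_, hUV⟩ ⟨trivial, rfl⟩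
    exact (congrArg Subtype.val h).symm
  · rw [hG U hU, hG V hV] at h
    exact congrArg Subtype.val (F.injective (Subtype.ext h))
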